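/- For $\alpha,\lambda>0$ let $G(\alpha,\lambda)$ denote the gamma distribution with density $f(x;\alpha,\lambda)=\frac{1}{\Gamma(\alpha)\lambda^{\alpha}}x^{\alpha-1}e^{-x/\lambda}$, $x>0$. For a sample $X_1,\dots,X_n$ let $\hat\alpha=\bar X^2/S^2$, where $\bar X=\frac1n\sum_{i=1}^n X_i$ is the sample mean and $S^2=\frac1n\sum_{i=1}^n(X_i-\bar X)^2$ is the biased sample variance; $\hat\alpha$ is the moment estimator of the shape parameter $\alpha$. For real random variables $U$ and $V$ with distribution functions $F$ and $G$ and quantile functions $F^{-1}(u)=\inf\{x: F(x)\ge u\}$ and $G^{-1}(u)=\inf\{x: G(x)\ge u\}$, write $U\le_{\mathrm{disp}}V$ if $$F^{-1}(v)-F^{-1}(u)\le G^{-1}(v)-G^{-1}(u)\qquad\text{whenever } 0<u\le v<1.$$ **Theorem.** For $n=2$ the estimator $\hat\alpha$ is dispersively increasing in $\alpha$. That is, let $0<\alpha_1<\alpha_2$ and $\lambda_1,\lambda_2>0$ (for instance $\lambda_1=\lambda_2$), let $\hat\alpha_1$ be the estimator computed from two independent random variables with distribution $G(\alpha_1,\lambda_1)$,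 and let $\hat\alpha_2$ be the estimator computed from two independent random variables with distribution $G(\alpha_2,\lambda_2)$. Then $\hat\alpha_1\le_{\mathrm{disp}}\hat\alpha_2$. -/

import Mathlib

open MeasureTheory ProbabilityTheory

/-- The sample mean `(X₁ + ⋯ + Xₙ) / n`. -/
noncomputable def sampleMean {Ω : Type*} {n : ℕ} (X : Fin n → Ω → ℝ) (ω : Ω) : ℝ :=
  (∑ i, X i ω) / (n : ℝ)

/-- The biased sample variance `((X₁ - X̄)² + ⋯ + (Xₙ - X̄)²) / n`. -/
noncomputable def sampleVariance {Ω : Type*} {n : ℕ} (X : Fin n → Ω → ℝ) (ω : Ω) : ℝ :=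
  (∑ i, (X i ω - sampleMean X ω) ^ 2) / (n : ℝ)

/-- The moment estimator `X̄² / S²` of the shape parameter of the gamma distribution. -/
noncomputable def shapeEstimator {Ω : Type*} {n : ℕ} (X : Fin n → Ω → ℝ) (ω : Ω) : ℝ :=
  sampleMean X ω ^ 2 / sampleVariance X ω

/-- `X₁, …, Xₙ` is a random sample (independent, identically distributed) from the gamma
distribution with shape `α` and scale `l`, whose density at `x > 0` is
`x ^ (α - 1) * exp (-x / l) / (Γ(α) * l ^ α)`. Mathlib's `gammaMeasure` is parametrized by the
shape and the rate `l⁻¹`. -/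
structure IsGammaSample {Ω : Type*} [MeasurableSpace Ω] {n : ℕ} (X : Fin n → Ω → ℝ)
    (α l : ℝ) (P : Measure Ω) : Prop where
  hasLaw : ∀ i, HasLaw (X i) (gammaMeasure α l⁻¹) P
  indep : iIndepFun X P

/-- The quantile function `F⁻¹(u) = inf {x | u ≤ F x}`, for `0 < u < 1`, where `F` is the
distribution function of the probability measure `μ` on `ℝ`. -/
noncomputable def quantile (μ : Measure ℝ) (u : ℝ) : ℝ :=
  sInf {x : ℝ | u ≤ cdf μ x}

/-- The dispersive order `U ≤_disp V` of real random variables, `U` on `(Ω₁, P₁)` and `V` on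
`(Ω₂, P₂)`: with `F` and `G` the distribution functions of `U` and `V`,
`F⁻¹(v) - F⁻¹(u) ≤ G⁻¹(v) - G⁻¹(u)` whenever `0 < u ≤ v < 1`. -/
def DispersiveLE {Ω₁ Ω₂ : Type*} [MeasurableSpace Ω₁] [MeasurableSpace Ω₂]
    (U : Ω₁ → ℝ) (P₁ : Measure Ω₁) (V : Ω₂ → ℝ) (P₂ : Measure Ω₂) : Prop :=
  ∀ u v : ℝ, 0 < u → u ≤ v → v < 1 →
    quantile (P₁.map U) v - quantile (P₁.map U) u ≤
      quantile (P₂.map V) v - quantile (P₂.map V) u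

/-! For two observations the estimator is `((X₁ + X₂) / (X₁ - X₂)) ^ 2`, a function of `X₁ / X₂`
alone. The scale therefore drops out, and the density at `z > 1` is proportional to `(z - 1) ^ (α -
1) * z ^ (-α - 1/2)`.

Let `F, f` and `G, g` be the distribution functions and densities for shapes `a < b`. At `c = 0` the
ratio `f / g` decreases, so `G ≤ F` (`le_of_logPDF`) and `c = G⁻¹(u) - F⁻¹(u)` is nonnegative. For
`c > 0` the slope of `log (f (x - c) / g x)` has the sign of a quadratic that stays negative once it
is negative (`logRatioNumerator_neg_of_lt`). So `F (x - c) - G x`, negative at `1 + c` and tending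
to `0`, cannot fall below zero after reaching it (`le_of_logPDF_of_eq`). It vanishes at `x =
G⁻¹(u)`, hence is nonnegative at `x = G⁻¹(v)`, which says `F⁻¹(v) ≤ G⁻¹(v) - c`. -/

open Set Filter Topology

/-! ### Ratio of two independent gamma variables -/

/-- The density of the ratio of two independent gamma variables of shape `a` and equal scale. -/
noncomputable def gammaRatioPDF (a r : ℝ) : ℝ :=
  if 0 < r then
    Real.Gamma (2 * a) / Real.Gamma a ^ 2 * (r ^ (a - 1) * (1 + r) ^ (-(2 * a)))
  else 0

lemma measurable_gammaRatioPDF (a : ℝ) : Measurable (gammaRatioPDF a) := by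
  unfold gammaRatioPDF
  exact Measurable.ite measurableSet_Ioi (by fun_prop) measurable_const

lemma gammaRatioPDF_nonneg {a : ℝ} (ha : 0 < a) (r : ℝ) : 0 ≤ gammaRatioPDF a r := by
  unfold gammaRatioPDF
  split_ifs with h <;> positivity

/-- As a function of `y`, the joint density along the ray of slope `r` is again a gamma density, of
shape `2 * a`, so `y` integrates out. At `r = 0` or `y = 0` the conventions for powers of zero can
break the identity. -/
lemma gammaPDF_mul_gammaPDF_scaled {a b r y : ℝ} (ha : 0 < a) (hb : 0 < b) (hr : r ≠ 0)
    (hy : y ≠ 0) :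
    gammaPDF a b y * (ENNReal.ofReal y * gammaPDF a b (r * y)) =
      ENNReal.ofReal (gammaRatioPDF a r) * gammaPDF (2 * a) (b * (1 + r)) y := by
  rcases hy.lt_or_gt with hy | hy
  · simp [gammaPDF_of_neg hy]
  rcases hr.lt_or_gt with hr | hr
  · rw [gammaPDF_of_neg (mul_neg_of_neg_of_pos hr hy)]
    simp [gammaRatioPDF, hr.not_gt]
  rw [gammaPDF_of_nonneg hy.le, gammaPDF_of_nonneg (by positivity : (0 : ℝ) ≤ r * y),
    gammaPDF_of_nonneg hy.le, ← ENNReal.ofReal_mul hy.le, ← ENNReal.ofReal_mul (by positivity),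
    ← ENNReal.ofReal_mul (gammaRatioPDF_nonneg ha r), gammaRatioPDF, if_pos hr]
  congr 1
  have hG : Real.Gamma a ≠ 0 := (Real.Gamma_pos_of_pos ha).ne'
  have hG2 : Real.Gamma (2 * a) ≠ 0 := (Real.Gamma_pos_of_pos (by positivity)).ne'
  have e1 : Real.exp (-(b * (1 + r) * y)) = Real.exp (-(b * y)) * Real.exp (-(b * (r * y))) := by
    rw [← Real.exp_add]; ring_nf
  have e2 : y ^ (2 * a - 1) = y ^ (a - 1) * y ^ (a - 1) * y := by
    conv_rhs => rw [← Real.rpow_add hy, ← Real.rpow_add_one hy.ne']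
    ring_nf
  have e3 : b ^ (2 * a) = b ^ a * b ^ a := by
    rw [← Real.rpow_add hb]; ring_nf
  have e4 : (1 + r) ^ (2 * a) ≠ 0 := (Real.rpow_pos_of_pos (by positivity) _).ne'
  rw [e1, e2, Real.mul_rpow hb.le (by positivity), e3, Real.mul_rpow hr.le hy.le,
    Real.rpow_neg (by positivity)]
  field_simp

lemma gammaMeasure_Iic_mul {a b y : ℝ} (k : ℝ) (hy : 0 < y) :
    gammaMeasure a b (Iic (k * y)) =
      ∫⁻ r in Iic k, ENNReal.ofReal y * gammaPDF a b (r * y) := by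
  have hm : Measurable (gammaPDF a b) := (measurable_gammaPDFReal a b).ennreal_ofReal
  rw [gammaMeasure, withDensity_apply _ measurableSet_Iic, ← lintegral_indicator measurableSet_Iic,
    ← lintegral_indicator measurableSet_Iic]
  conv_lhs => rw [← Real.smul_map_volume_mul_right hy.ne']
  have hm' : Measurable fun x => (Iic (k * y)).indicator (gammaPDF a b) (x * y) :=
    (hm.indicator measurableSet_Iic).comp (measurable_id.mul_const y)
  rw [lintegral_smul_measure, lintegral_map (hm.indicator measurableSet_Iic) (by fun_prop),
    smul_eq_mul, ← lintegral_const_mul _ hm']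
  refine lintegral_congr fun r => ?_
  by_cases h : r ≤ k
  · simp [indicator, h, hy, abs_of_pos hy]
  · simp [indicator, h, hy]

lemma gammaMeasure_prod_ratio {a b : ℝ} (ha : 0 < a) (hb : 0 < b) (k : ℝ) :
    ((gammaMeasure a b).prod (gammaMeasure a b)) {p | p.1 ≤ k * p.2} =
      ∫⁻ r in Iic k, ENNReal.ofReal (gammaRatioPDF a r) := by
  have := isProbabilityMeasure_gammaMeasure ha hb
  have hm : Measurable (gammaPDF a b) := (measurable_gammaPDFReal a b).ennreal_ofReal
  have hne : ∀ᵐ y : ℝ, y ≠ 0 := by simp [ae_iff]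
  have hs : MeasurableSet {p : ℝ × ℝ | p.1 ≤ k * p.2} :=
    measurableSet_le (by fun_prop) (by fun_prop)
  rw [Measure.prod_apply_symm hs]
  have hslice : ∀ y : ℝ, (fun x => (x, y)) ⁻¹' {p : ℝ × ℝ | p.1 ≤ k * p.2} = Iic (k * y) :=
    fun y => rfl
  simp only [hslice]
  conv_lhs => rw [gammaMeasure]
  rw [lintegral_withDensity_eq_lintegral_mul_non_measurable _ hm (ae_of_all _ fun y => by simp [gammaPDF])]
  calc ∫⁻ y, (gammaPDF a b * fun y => gammaMeasure a b (Iic (k * y))) y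
      = ∫⁻ y, ∫⁻ r in Iic k, gammaPDF a b y * (ENNReal.ofReal y * gammaPDF a b (r * y)) := by
        refine lintegral_congr_ae (hne.mono fun y hy => ?_)
        simp only [Pi.mul_apply]
        rcases hy.lt_or_gt with hy | hy
        · simp [gammaPDF_of_neg hy]
        · have hm' : Measurable fun r => ENNReal.ofReal y * gammaPDF a b (r * y) := by fun_prop
          rw [gammaMeasure_Iic_mul k hy, lintegral_const_mul _ hm']
    _ = ∫⁻ r in Iic k, ∫⁻ y, gammaPDF a b y * (ENNReal.ofReal y * gammaPDF a b (r * y)) :=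
        lintegral_lintegral_swap (by unfold Function.uncurry; fun_prop)
    _ = _ := by
        refine lintegral_congr_ae (ae_restrict_of_ae (hne.mono fun r hr => ?_))
        simp only
        rw [lintegral_congr_ae (hne.mono fun y hy => gammaPDF_mul_gammaPDF_scaled ha hb hr hy),
          lintegral_const_mul _ (by exact (measurable_gammaPDFReal _ _).ennreal_ofReal)]
        -- For `r < 0` the rate `b * (1 + r)` may fail to be positive, but the factor `gammaRatioPDF
        -- a r` vanishes.
        rcases hr.lt_or_gt with hr | hr
        · simp [gammaRatioPDF, hr.not_gt]
        · rw [lintegral_gammaPDF_eq_one (by positivity) (by positivity), mul_one]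

/-- The distribution function of the ratio of two independent gamma variables. -/
noncomputable def gammaRatioCDF (a k : ℝ) : ℝ :=
  (∫⁻ r in Iic k, ENNReal.ofReal (gammaRatioPDF a r)).toReal

lemma gammaRatioPDF_integrable {a : ℝ} (ha : 0 < a) (k : ℝ) :
    IntegrableOn (gammaRatioPDF a) (Iic k) := by
  refine ⟨(measurable_gammaRatioPDF a).aestronglyMeasurable, ?_⟩
  rw [hasFiniteIntegral_iff_ofReal (ae_of_all _ (gammaRatioPDF_nonneg ha)),
    ← gammaMeasure_prod_ratio ha one_pos]
  have := isProbabilityMeasure_gammaMeasure ha one_pos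
  exact measure_lt_top _ _

lemma gammaRatioCDF_eq_integral {a : ℝ} (ha : 0 < a) (k : ℝ) :
    gammaRatioCDF a k = ∫ r in Iic k, gammaRatioPDF a r := by
  rw [integral_eq_lintegral_of_nonneg_ae (ae_of_all _ (gammaRatioPDF_nonneg ha))
    (measurable_gammaRatioPDF a).aestronglyMeasurable]
  rfl

lemma hasDerivAt_gammaRatioCDF {a k : ℝ} (ha : 0 < a) (hk : 0 < k) :
    HasDerivAt (gammaRatioCDF a) (gammaRatioPDF a k) k := by
  have hc : ContinuousAt (gammaRatioPDF a) k := by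
    have : ContinuousAt (fun r : ℝ => Real.Gamma (2 * a) / Real.Gamma a ^ 2 *
        (r ^ (a - 1) * (1 + r) ^ (-(2 * a)))) k := by
      refine continuousAt_const.mul ((Real.continuousAt_rpow_const _ _ (Or.inl hk.ne')).mul ?_)
      exact ContinuousAt.rpow_const (by fun_prop) (Or.inl (by positivity))
    refine this.congr ?_
    filter_upwards [lt_mem_nhds hk] with r hr
    simp [gammaRatioPDF, hr]
  have hi : IntervalIntegrable (gammaRatioPDF a) volume 0 k := by
    rw [intervalIntegrable_iff_integrableOn_Ioc_of_le hk.le]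
    exact (gammaRatioPDF_integrable ha k).mono_set Ioc_subset_Iic_self
  have h := intervalIntegral.integral_hasDerivAt_right hi
    ((measurable_gammaRatioPDF a).stronglyMeasurable.stronglyMeasurableAtFilter) hc
  have heq : gammaRatioCDF a = fun x => gammaRatioCDF a 0 + ∫ r in (0 : ℝ)..x, gammaRatioPDF a r := by
    funext x
    rw [gammaRatioCDF_eq_integral ha, gammaRatioCDF_eq_integral ha,
      ← intervalIntegral.integral_Iic_sub_Iic (gammaRatioPDF_integrable ha 0)
        (gammaRatioPDF_integrable ha x)]
    ring
  rw [heq]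
  exact h.const_add _

/-! ### Law of the estimator for two observations -/

/-- The moment estimator of the gamma shape parameter as a function of a sample of size two. -/
noncomputable def pairShapeEstimator (p : ℝ × ℝ) : ℝ := (p.1 + p.2) ^ 2 / (p.1 - p.2) ^ 2

lemma measurable_pairShapeEstimator : Measurable pairShapeEstimator := by
  unfold pairShapeEstimator
  fun_prop

lemma shapeEstimator_two {Ω : Type*} (X : Fin 2 → Ω → ℝ) (ω : Ω) :
    shapeEstimator X ω = pairShapeEstimator (X 0 ω, X 1 ω) := by
  have h : sampleVariance X ω = (X 0 ω - X 1 ω) ^ 2 / 4 := by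
    simp only [sampleVariance, sampleMean, Fin.sum_univ_two]
    push_cast
    ring
  rw [shapeEstimator, h, pairShapeEstimator, sampleMean, Fin.sum_univ_two]
  push_cast
  rw [div_pow, show (2 : ℝ) ^ 2 = 4 by norm_num, div_div_div_cancel_right₀ (by norm_num)]

/-- The law of the moment estimator for a sample of size two. -/
noncomputable def shapeEstimatorLaw (a b : ℝ) : Measure ℝ :=
  ((gammaMeasure a b).prod (gammaMeasure a b)).map pairShapeEstimator

lemma isProbabilityMeasure_shapeEstimatorLaw {a b : ℝ} (ha : 0 < a) (hb : 0 < b) :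
    IsProbabilityMeasure (shapeEstimatorLaw a b) := by
  have := isProbabilityMeasure_gammaMeasure ha hb
  exact Measure.isProbabilityMeasure_map measurable_pairShapeEstimator.aemeasurable

lemma IsGammaSample.map_shapeEstimator {Ω : Type*} [MeasurableSpace Ω] {P : Measure Ω}
    [IsProbabilityMeasure P] {X : Fin 2 → Ω → ℝ} {a l : ℝ} (h : IsGammaSample X a l P) :
    P.map (shapeEstimator X) = shapeEstimatorLaw a l⁻¹ := by
  have hind : IndepFun (X 0) (X 1) P := h.indep.indepFun (by decide)
  have hpair := (indepFun_iff_map_prod_eq_prod_map_map (h.hasLaw 0).aemeasurable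
    (h.hasLaw 1).aemeasurable).1 hind
  rw [(h.hasLaw 0).map_eq, (h.hasLaw 1).map_eq] at hpair
  have hfun : shapeEstimator X = pairShapeEstimator ∘ fun ω => (X 0 ω, X 1 ω) :=
    funext (shapeEstimator_two X)
  rw [shapeEstimatorLaw, ← hpair, hfun, AEMeasurable.map_map_of_aemeasurable
    measurable_pairShapeEstimator.aemeasurable
    ((h.hasLaw 0).aemeasurable.prodMk (h.hasLaw 1).aemeasurable)]

lemma ae_pos_gammaMeasure (a b : ℝ) : ∀ᵐ x ∂gammaMeasure a b, 0 < x := by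
  have hm : Measurable (gammaPDF a b) := (measurable_gammaPDFReal a b).ennreal_ofReal
  have hne : ∀ᵐ y : ℝ, y ≠ 0 := by simp [ae_iff]
  rw [gammaMeasure, ae_withDensity_iff hm]
  filter_upwards [hne] with x hx hx'
  by_contra! hle
  exact hx' (gammaPDF_of_neg (lt_of_le_of_ne hle hx))

/-- Discards the diagonal, where the estimator takes the default value `0` of division by zero. -/
lemma ae_gammaMeasure_prod {a b : ℝ} (ha : 0 < a) (hb : 0 < b) :
    ∀ᵐ p ∂(gammaMeasure a b).prod (gammaMeasure a b), 0 < p.1 ∧ 0 < p.2 ∧ p.1 ≠ p.2 := by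
  have := isProbabilityMeasure_gammaMeasure ha hb
  have h1 : ∀ᵐ p ∂(gammaMeasure a b).prod (gammaMeasure a b), 0 < p.1 :=
    Measure.quasiMeasurePreserving_fst.ae (ae_pos_gammaMeasure a b)
  have h2 : ∀ᵐ p ∂(gammaMeasure a b).prod (gammaMeasure a b), 0 < p.2 :=
    Measure.quasiMeasurePreserving_snd.ae (ae_pos_gammaMeasure a b)
  have h3 : ∀ᵐ p ∂(gammaMeasure a b).prod (gammaMeasure a b), p.1 ≠ p.2 := by
    have hs : MeasurableSet {p : ℝ × ℝ | ¬ p.1 ≠ p.2} := by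
      simpa using measurableSet_eq_fun (f := fun p : ℝ × ℝ => p.1) (g := fun p => p.2)
        (by fun_prop) (by fun_prop)
    rw [ae_iff, Measure.measure_prod_null hs]
    refine ae_of_all _ fun x => ?_
    have hx : Prod.mk x ⁻¹' {p : ℝ × ℝ | ¬ p.1 ≠ p.2} = {x} := by
      ext y; simp [eq_comm]
    change gammaMeasure a b (Prod.mk x ⁻¹' {p : ℝ × ℝ | ¬ p.1 ≠ p.2}) = 0
    rw [hx, gammaMeasure]
    exact withDensity_absolutelyContinuous _ _ (by simp)
  filter_upwards [h1, h2, h3] with p a b c using ⟨a, b, c⟩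

lemma one_lt_pairShapeEstimator {p : ℝ × ℝ} (h1 : 0 < p.1) (h2 : 0 < p.2) (h : p.1 ≠ p.2) :
    1 < pairShapeEstimator p := by
  have : 0 < (p.1 - p.2) ^ 2 := by have := sub_ne_zero.2 h; positivity
  rw [pairShapeEstimator, one_lt_div this]
  nlinarith [mul_pos h1 h2]

lemma pairShapeEstimator_le_iff {p : ℝ × ℝ} {w : ℝ} (hw : 1 < w) (h1 : 0 < p.1) (h2 : 0 < p.2)
    (h : p.1 ≠ p.2) :
    pairShapeEstimator p ≤ w ^ 2 ↔
      p.1 ≤ (w - 1) / (w + 1) * p.2 ∨ p.2 ≤ (w - 1) / (w + 1) * p.1 := by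
  have : 0 < (p.1 - p.2) ^ 2 := by have := sub_ne_zero.2 h; positivity
  rw [pairShapeEstimator, div_le_iff₀ this, ← mul_pow, sq_le_sq, abs_of_pos (by positivity),
    abs_mul, abs_of_pos (by positivity : 0 < w), div_mul_eq_mul_div, div_mul_eq_mul_div,
    le_div_iff₀ (by positivity), le_div_iff₀ (by positivity)]
  constructor
  · intro hle
    rcases le_total p.1 p.2 with hp | hp
    · rw [abs_of_nonpos (by linarith)] at hle
      left; linarith
    · rw [abs_of_nonneg (by linarith)] at hle
      right; linarith
  · rintro (hle | hle)
    · nlinarith [neg_abs_le (p.1 - p.2)]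
    · nlinarith [le_abs_self (p.1 - p.2)]

lemma cdf_shapeEstimatorLaw_of_le_one {a b z : ℝ} (ha : 0 < a) (hb : 0 < b) (hz : z ≤ 1) :
    cdf (shapeEstimatorLaw a b) z = 0 := by
  have := isProbabilityMeasure_shapeEstimatorLaw ha hb
  rw [cdf_eq_real, shapeEstimatorLaw,
    map_measureReal_apply measurable_pairShapeEstimator measurableSet_Iic, measureReal_def]
  have : ((gammaMeasure a b).prod (gammaMeasure a b)) (pairShapeEstimator ⁻¹' Iic z) = 0 := by
    refine measure_mono_null ?_ (ae_iff.1 (ae_gammaMeasure_prod ha hb))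
    intro p hp hp'
    exact (one_lt_pairShapeEstimator hp'.1 hp'.2.1 hp'.2.2).not_ge (le_trans hp hz)
  rw [this, ENNReal.toReal_zero]

/-- Up to a null set the event says that one observation is at most `k` times the other. The two
cases are equally likely by symmetry and disjoint because `k < 1`. -/
lemma cdf_shapeEstimatorLaw_sq {a b w : ℝ} (ha : 0 < a) (hb : 0 < b) (hw : 1 < w) :
    cdf (shapeEstimatorLaw a b) (w ^ 2) = 2 * gammaRatioCDF a ((w - 1) / (w + 1)) := by
  have := isProbabilityMeasure_shapeEstimatorLaw ha hb
  have := isProbabilityMeasure_gammaMeasure ha hb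
  set k := (w - 1) / (w + 1) with hk
  have hk1 : k < 1 := by rw [hk, div_lt_one (by linarith)]; linarith
  have hk0 : 0 < k := div_pos (by linarith) (by linarith)
  have hs1 : MeasurableSet {p : ℝ × ℝ | p.1 ≤ k * p.2} :=
    measurableSet_le (by fun_prop) (by fun_prop)
  have hs2 : MeasurableSet {p : ℝ × ℝ | p.2 ≤ k * p.1} :=
    measurableSet_le (by fun_prop) (by fun_prop)
  have hswap : ((gammaMeasure a b).prod (gammaMeasure a b)) {p | p.2 ≤ k * p.1} =
      ((gammaMeasure a b).prod (gammaMeasure a b)) {p | p.1 ≤ k * p.2} := by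
    conv_lhs => rw [← Measure.prod_swap, Measure.map_apply measurable_swap hs2]
    rfl
  have hdisj : AEDisjoint ((gammaMeasure a b).prod (gammaMeasure a b))
      {p : ℝ × ℝ | p.1 ≤ k * p.2} {p : ℝ × ℝ | p.2 ≤ k * p.1} := by
    refine measure_mono_null ?_ (ae_iff.1 (ae_gammaMeasure_prod ha hb))
    rintro p ⟨hp1, hp2⟩ ⟨h1, h2, -⟩
    simp only [mem_ofPred_eq] at hp1 hp2
    nlinarith
  have hset : pairShapeEstimator ⁻¹' Iic (w ^ 2) =ᵐ[(gammaMeasure a b).prod (gammaMeasure a b)]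
      ({p : ℝ × ℝ | p.1 ≤ k * p.2} ∪ {p : ℝ × ℝ | p.2 ≤ k * p.1} : Set (ℝ × ℝ)) := by
    filter_upwards [ae_gammaMeasure_prod ha hb] with p hp
    exact propext (pairShapeEstimator_le_iff hw hp.1 hp.2.1 hp.2.2)
  rw [cdf_eq_real, shapeEstimatorLaw,
    map_measureReal_apply measurable_pairShapeEstimator measurableSet_Iic, measureReal_def,
    measure_congr hset, measure_union₀ hs2.nullMeasurableSet hdisj, hswap,
    gammaMeasure_prod_ratio ha hb, ← two_mul, ENNReal.toReal_mul, gammaRatioCDF]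
  rfl

/-- The logarithm, up to the additive constant `K`, of the density at `z > 1` of the moment
estimator for a gamma sample of size two and shape `a`. -/
noncomputable def shapeEstimatorLogPDF (K a z : ℝ) : ℝ :=
  K + a * (Real.log (z - 1) - Real.log z) - Real.log (z - 1) - Real.log z / 2

/-- The value of `K` is never needed: normalization enters later only through the limit `1` of the
distribution function. -/
lemma exists_hasDerivAt_cdf_shapeEstimatorLaw {a b : ℝ} (ha : 0 < a) (hb : 0 < b) :
    ∃ K, ∀ z, 1 < z → HasDerivAt (cdf (shapeEstimatorLaw a b))
      (Real.exp (shapeEstimatorLogPDF K a z)) z := by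
  have hC : 0 < Real.Gamma (2 * a) / Real.Gamma a ^ 2 := by positivity
  refine ⟨Real.log 2 + Real.log (Real.Gamma (2 * a) / Real.Gamma a ^ 2) - a * (2 * Real.log 2),
    fun z hz => ?_⟩
  set w := √z with hw
  have hz0 : 0 < z := by linarith
  have hw1 : 1 < w := by rw [hw]; exact Real.lt_sqrt_of_sq_lt (by linarith)
  have hwz : w ^ 2 = z := Real.sq_sqrt hz0.le
  have hk0 : 0 < (w - 1) / (w + 1) := div_pos (by linarith) (by linarith)
  have hd : HasDerivAt (fun z : ℝ => (√z - 1) / (√z + 1)) (1 / (w * (w + 1) ^ 2)) z := by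
    have hs := Real.hasDerivAt_sqrt hz0.ne'
    refine ((hs.sub_const 1).div (hs.add_const 1) (by positivity)).congr_deriv ?_
    rw [← hw]
    field_simp
    ring
  have h := ((hasDerivAt_gammaRatioCDF ha hk0).comp z hd).const_mul 2
  have heq : cdf (shapeEstimatorLaw a b) =ᶠ[𝓝 z]
      fun z => 2 * (gammaRatioCDF a ∘ fun z : ℝ => (√z - 1) / (√z + 1)) z := by
    filter_upwards [lt_mem_nhds hz] with x hx
    have := cdf_shapeEstimatorLaw_sq ha hb (w := √x) (Real.lt_sqrt_of_sq_lt (by linarith))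
    rw [Real.sq_sqrt (by linarith)] at this
    exact this
  refine (h.congr_of_eventuallyEq heq).congr_deriv ?_
  have hk1 : 1 + (w - 1) / (w + 1) = 2 * w / (w + 1) := by field_simp; ring
  have hw1' : 0 < w - 1 := by linarith
  have hwp : 0 < w + 1 := by linarith
  have hw0 : 0 < w := by linarith
  rw [gammaRatioPDF, if_pos hk0, hk1, Real.rpow_def_of_pos hk0, Real.rpow_def_of_pos (by positivity)]
  have hpos : 0 < 1 / (w * (w + 1) ^ 2) := by positivity
  -- With every factor an exponential, the claim becomes a linear identity between logarithms.
  rw [← Real.exp_log hC, ← Real.exp_log hpos]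
  conv_lhs => rw [← Real.exp_log (show (0 : ℝ) < 2 by norm_num)]
  rw [← Real.exp_add, ← Real.exp_add, ← Real.exp_add, ← Real.exp_add, Real.exp_log hC,
    Real.exp_log two_pos]
  congr 1
  have e1 : z - 1 = (w - 1) * (w + 1) := by rw [← hwz]; ring
  rw [shapeEstimatorLogPDF, e1, ← hwz, Real.log_mul hw1'.ne' hwp.ne', Real.log_pow,
    Real.log_div hw1'.ne' hwp.ne', Real.log_div (by positivity) hwp.ne',
    Real.log_mul two_ne_zero hw0.ne', Real.log_div one_ne_zero (by positivity),
    Real.log_mul hw0.ne' (by positivity), Real.log_pow, Real.log_one]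
  push_cast
  ring

/-- At `z = 1` the density may blow up (`a < 1`); there right continuity of the distribution
function is used. -/
lemma continuous_cdf_shapeEstimatorLaw {a b : ℝ} (ha : 0 < a) (hb : 0 < b) :
    Continuous (cdf (shapeEstimatorLaw a b)) := by
  obtain ⟨K, hK⟩ := exists_hasDerivAt_cdf_shapeEstimatorLaw ha hb
  refine continuous_iff_continuousAt.2 fun z => ?_
  rcases lt_or_ge 1 z with hz | hz
  · exact (hK z hz).continuousAt
  · refine continuousAt_iff_continuous_left'_right'.2 ⟨?_, ?_⟩
    · have h0 : cdf (shapeEstimatorLaw a b) z = 0 := cdf_shapeEstimatorLaw_of_le_one ha hb hz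
      rw [ContinuousWithinAt, h0]
      refine tendsto_const_nhds.congr' ?_
      filter_upwards [self_mem_nhdsWithin] with x hx
      exact (cdf_shapeEstimatorLaw_of_le_one ha hb (le_trans (le_of_lt hx) hz)).symm
    · exact ((cdf (shapeEstimatorLaw a b)).right_continuous z).mono Ioi_subset_Ici_self

lemma hasDerivAt_shapeEstimatorLogPDF (K a : ℝ) {z : ℝ} (hz : 1 < z) :
    HasDerivAt (shapeEstimatorLogPDF K a)
      ((a - 1 - 3 / 2 * (z - 1)) / ((z - 1) * z)) z := by
  have h1 : z - 1 ≠ 0 := by linarith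
  have h0 : z ≠ 0 := by linarith
  have hl1 : HasDerivAt (fun z : ℝ => Real.log (z - 1)) (1 / (z - 1)) z :=
    ((hasDerivAt_id z).sub_const 1).log h1
  have hl0 : HasDerivAt (fun z : ℝ => Real.log z) (1 / z) z := (hasDerivAt_id z).log h0
  have h := ((((hl1.sub hl0).const_mul a).const_add K).sub hl1).sub (hl0.div_const 2)
  refine h.congr_deriv ?_
  field_simp
  ring

/-! ### Monotonicity of the shifted log-density ratio -/

/-- The numerator of the derivative of `t ↦ log (f (t + 1) / g (t + 1 + c))`, for `f` and `g` the
densities of the moment estimator with shapes `a` and `b`. -/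
noncomputable def logRatioNumerator (a b c t : ℝ) : ℝ :=
  (a - 1 - 3 / 2 * t) * ((t + c) * (t + c + 1)) - (b - 1 - 3 / 2 * (t + c)) * (t * (t + 1))

lemma logRatioNumerator_zero_neg {a b t : ℝ} (hab : a < b) (ht : 0 < t) :
    logRatioNumerator a b 0 t < 0 := by
  have : 0 < (b - a) * (t * (t + 1)) := mul_pos (by linarith) (by positivity)
  unfold logRatioNumerator
  linarith

lemma logRatioNumerator_neg_of_lt {a b c t₁ t₂ : ℝ} (hab : a < b) (hc : 0 ≤ c)
    (ht₁ : 0 < t₁) (ht : t₁ < t₂) (hneg : logRatioNumerator a b c t₁ < 0) :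
    logRatioNumerator a b c t₂ < 0 := by
  have hq : ∀ t, logRatioNumerator a b c t = (a - b - 3 / 2 * c) * t ^ 2 +
      ((a - b) + 2 * c * (a - 1) - 3 / 2 * c ^ 2) * t + (a - 1) * (c * (c + 1)) := by
    intro t; unfold logRatioNumerator; ring
  have ht₂ : 0 < t₂ := ht₁.trans ht
  rw [hq] at hneg ⊢
  set A := a - b - 3 / 2 * c with hA
  set B := (a - b) + 2 * c * (a - 1) - 3 / 2 * c ^ 2 with hB
  have hA0 : A < 0 := by rw [hA]; linarith
  -- If `1 ≤ a`, the constant term is nonnegative and `A * t + B + E / t` is decreasing. If `a < 1`,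
  -- no coefficient is positive, so the quadratic is negative for every `t > 0`.
  rcases le_or_gt 1 a with ha | ha
  · set E := (a - 1) * (c * (c + 1)) with hE
    have hE0 : 0 ≤ E := mul_nonneg (by linarith) (by positivity)
    have h1 : (A * t₁ ^ 2 + B * t₁ + E) * t₂ < 0 := mul_neg_of_neg_of_pos hneg ht₂
    have h2 : 0 < t₁ * t₂ * (t₂ - t₁) * (-A) := by
      have : 0 < t₂ - t₁ := by linarith
      have : 0 < -A := by linarith
      positivity
    have h3 : 0 ≤ E * (t₂ - t₁) := mul_nonneg hE0 (by linarith)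
    have h4 : (A * t₂ ^ 2 + B * t₂ + E) * t₁ < 0 := by nlinarith
    by_contra! h5
    exact h4.not_ge (mul_nonneg h5 ht₁.le)
  · have hB0 : B < 0 := by
      have : 0 ≤ c * (1 - a) := mul_nonneg hc (by linarith)
      rw [hB]; nlinarith
    have h1 : 0 < -A * t₂ ^ 2 := mul_pos (by linarith) (by positivity)
    have h2 : 0 < -B * t₂ := mul_pos (by linarith) ht₂
    have h3 : 0 ≤ (1 - a) * (c * (c + 1)) := mul_nonneg (by linarith) (by positivity)
    linarith

lemma exists_logRatioNumerator_eq_slope {K K' a b c x y : ℝ} (hc : 0 ≤ c) (hx : 1 + c < x)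
    (hxy : x < y) :
    ∃ ξ ∈ Ioo x y, ∃ d > 0, logRatioNumerator a b c (ξ - c - 1) =
      d * ((shapeEstimatorLogPDF K a (y - c) - shapeEstimatorLogPDF K' b y) -
        (shapeEstimatorLogPDF K a (x - c) - shapeEstimatorLogPDF K' b x)) := by
  have hder : ∀ z, 1 + c < z → HasDerivAt
      (fun z => shapeEstimatorLogPDF K a (z - c) - shapeEstimatorLogPDF K' b z)
      ((a - 1 - 3 / 2 * (z - c - 1)) / ((z - c - 1) * (z - c)) -
        (b - 1 - 3 / 2 * (z - 1)) / ((z - 1) * z)) z := fun z hz =>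
    (HasDerivAt.comp_sub_const z c
      (hasDerivAt_shapeEstimatorLogPDF K a (z := z - c) (by linarith))).sub
      (hasDerivAt_shapeEstimatorLogPDF K' b (by linarith))
  obtain ⟨ξ, hξ, h⟩ := exists_hasDerivAt_eq_slope _ _ hxy
    (fun z hz => (hder z (by linarith [hz.1])).continuousAt.continuousWithinAt)
    (fun z hz => hder z (by linarith [hz.1]))
  have h1 : 0 < ξ - c - 1 := by linarith [hξ.1]
  have h2 : 0 < ξ - c := by linarith
  have h3 : 0 < ξ - 1 := by linarith
  have h4 : 0 < ξ := by linarith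
  have h5 : 0 < y - x := by linarith
  refine ⟨ξ, hξ, (ξ - c - 1) * (ξ - c) * (ξ - 1) * ξ / (y - x), by positivity, ?_⟩
  rw [div_mul_eq_mul_div, mul_div_assoc, ← h, logRatioNumerator]
  field_simp
  ring

/-! ### Crossings of the shifted distribution functions -/

section Crossing

variable {F G : ℝ → ℝ} {K K' a b c : ℝ}

/-- The derivative of `F (z - c) - G z` is a difference of exponentials, so the mean value theorem
turns a rise or fall into a sign of the log ratio. -/
lemma exists_logPDF_sign (hFc : Continuous F) (hGc : Continuous G)
    (hF : ∀ z, 1 < z → HasDerivAt F (Real.exp (shapeEstimatorLogPDF K a z)) z)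
    (hG : ∀ z, 1 < z → HasDerivAt G (Real.exp (shapeEstimatorLogPDF K' b z)) z)
    (hc : 0 ≤ c) {x y : ℝ} (hx : 1 + c ≤ x) (hxy : x < y) :
    ∃ ξ ∈ Ioo x y,
      (F (x - c) - G x < F (y - c) - G y →
        0 < shapeEstimatorLogPDF K a (ξ - c) - shapeEstimatorLogPDF K' b ξ) ∧
      (F (y - c) - G y < F (x - c) - G x →
        shapeEstimatorLogPDF K a (ξ - c) - shapeEstimatorLogPDF K' b ξ < 0) := by
  obtain ⟨ξ, hξ, h⟩ := exists_hasDerivAt_eq_slope (fun z => F (z - c) - G z)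
    (fun z => Real.exp (shapeEstimatorLogPDF K a (z - c)) -
      Real.exp (shapeEstimatorLogPDF K' b z)) hxy
    (by fun_prop)
    (fun z hz => (HasDerivAt.comp_sub_const z c (hF (z - c) (by linarith [hz.1]))).sub
      (hG z (by linarith [hz.1])))
  have h5 : 0 < y - x := by linarith
  refine ⟨ξ, hξ, fun hlt => ?_, fun hlt => ?_⟩
  · have : 0 < (F (y - c) - G y - (F (x - c) - G x)) / (y - x) := div_pos (by linarith) h5
    rw [← h, sub_pos, Real.exp_lt_exp] at this
    linarith
  · have : (F (y - c) - G y - (F (x - c) - G x)) / (y - x) < 0 :=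
      div_neg_of_neg_of_pos (by linarith) h5
    rw [← h, sub_neg, Real.exp_lt_exp] at this
    linarith

lemma exists_gt_of_neg_of_tendsto (hFt : Tendsto F atTop (𝓝 1)) (hGt : Tendsto G atTop (𝓝 1))
    {x : ℝ} (hx : F (x - c) - G x < 0) :
    ∃ y, x < y ∧ F (x - c) - G x < F (y - c) - G y := by
  have h : Tendsto (fun z => F (z - c) - G z) atTop (𝓝 0) := by
    have h1 : Tendsto (fun z => F (z - c)) atTop (𝓝 1) :=
      hFt.comp (tendsto_atTop_add_const_right _ (-c) tendsto_id)
    simpa using h1.sub hGt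
  exact ((eventually_gt_atTop x).and (h.eventually (lt_mem_nhds hx))).exists

lemma le_of_logPDF (hFc : Continuous F) (hGc : Continuous G)
    (hF0 : ∀ z ≤ 1, F z = 0) (hG0 : ∀ z ≤ 1, G z = 0)
    (hFt : Tendsto F atTop (𝓝 1)) (hGt : Tendsto G atTop (𝓝 1))
    (hF : ∀ z, 1 < z → HasDerivAt F (Real.exp (shapeEstimatorLogPDF K a z)) z)
    (hG : ∀ z, 1 < z → HasDerivAt G (Real.exp (shapeEstimatorLogPDF K' b z)) z)
    (hab : a < b) (x : ℝ) : G x ≤ F x := by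
  rcases le_or_gt x 1 with hx | hx
  · rw [hF0 x hx, hG0 x hx]
  by_contra! hlt
  obtain ⟨y, hxy, hy⟩ := exists_gt_of_neg_of_tendsto (c := 0) hFt hGt (x := x) (by simpa using hlt)
  obtain ⟨ξ₁, hξ₁, -, h₁⟩ := exists_logPDF_sign (c := 0) hFc hGc hF hG le_rfl (by simp) hx
  obtain ⟨ξ₂, hξ₂, h₂, -⟩ := exists_logPDF_sign (c := 0) hFc hGc hF hG le_rfl (by linarith) hxy
  -- The difference falls from `0` at `1` and later rises, so the log ratio goes from negative to
  -- positive although it is decreasing.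
  have h₁' := h₁ (by rw [sub_zero, sub_zero, hF0 1 le_rfl, hG0 1 le_rfl]; linarith)
  have h₂' := h₂ hy
  obtain ⟨η, hη, d, hd, h⟩ := exists_logRatioNumerator_eq_slope (K := K) (K' := K') (a := a)
    (b := b) (c := 0) le_rfl (by linarith [hξ₁.1]) (hξ₁.2.trans hξ₂.1)
  have hneg := logRatioNumerator_zero_neg (t := η - 0 - 1) hab (by linarith [hη.1, hξ₁.1])
  rw [h] at hneg
  have := mul_pos hd (sub_pos.2 (h₁'.trans h₂'))
  linarith

lemma le_of_logPDF_of_eq (hFc : Continuous F) (hGc : Continuous G)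
    (hF0 : ∀ z ≤ 1, F z = 0) (hG0 : ∀ z ≤ 1, G z = 0)
    (hFt : Tendsto F atTop (𝓝 1)) (hGt : Tendsto G atTop (𝓝 1))
    (hF : ∀ z, 1 < z → HasDerivAt F (Real.exp (shapeEstimatorLogPDF K a z)) z)
    (hG : ∀ z, 1 < z → HasDerivAt G (Real.exp (shapeEstimatorLogPDF K' b z)) z)
    (hab : a < b) (hc : 0 < c) {s x : ℝ} (hs : 1 + c < s) (heq : F (s - c) = G s) (hsx : s ≤ x) :
    G x ≤ F (x - c) := by
  by_contra! hlt
  have hsx' : s < x := lt_of_le_of_ne hsx (by rintro rfl; linarith)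
  have hGpos : 0 < G (1 + c) := by
    obtain ⟨ξ, hξ, h⟩ := exists_hasDerivAt_eq_slope G
      (fun z => Real.exp (shapeEstimatorLogPDF K' b z)) (by linarith : (1 : ℝ) < 1 + c)
      hGc.continuousOn (fun z hz => hG z hz.1)
    have := Real.exp_pos (shapeEstimatorLogPDF K' b ξ)
    rw [h, hG0 1 le_rfl, sub_zero, add_sub_cancel_left] at this
    exact (div_pos_iff_of_pos_right hc).1 this
  have hF1 : F (1 + c - c) = 0 := hF0 _ (by simp)
  obtain ⟨y, hxy, hy⟩ := exists_gt_of_neg_of_tendsto (c := c) hFt hGt (x := x) (by linarith)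
  obtain ⟨ξ₁, hξ₁, h₁, -⟩ := exists_logPDF_sign hFc hGc hF hG hc.le le_rfl hs
  obtain ⟨ξ₂, hξ₂, -, h₂⟩ := exists_logPDF_sign hFc hGc hF hG hc.le hs.le hsx'
  obtain ⟨ξ₃, hξ₃, h₃, -⟩ := exists_logPDF_sign hFc hGc hF hG hc.le (hs.trans hsx').le hxy
  -- The difference rises up to `s`, falls to `x`, then rises again: the log ratio is positive,
  -- negative, positive, so it would increase after having decreased.
  have h₁' := h₁ (by linarith)
  have h₂' := h₂ (by linarith)
  have h₃' := h₃ hy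
  obtain ⟨η₁, hη₁, d₁, hd₁, e₁⟩ := exists_logRatioNumerator_eq_slope (K := K) (K' := K') (a := a)
    (b := b) hc.le hξ₁.1 (hξ₁.2.trans hξ₂.1)
  obtain ⟨η₂, hη₂, d₂, hd₂, e₂⟩ := exists_logRatioNumerator_eq_slope (K := K) (K' := K') (a := a)
    (b := b) hc.le (hs.trans hξ₂.1) (hξ₂.2.trans hξ₃.1)
  have hneg := logRatioNumerator_neg_of_lt (t₁ := η₁ - c - 1) (t₂ := η₂ - c - 1) hab hc.le
    (by linarith [hξ₁.1, hη₁.1]) (by linarith [hη₁.2, hη₂.1])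
    (by rw [e₁]; exact mul_neg_of_pos_of_neg hd₁ (by linarith))
  rw [e₂] at hneg
  have := mul_pos hd₂ (sub_pos.2 (h₂'.trans h₃'))
  linarith

end Crossing

/-! ### Quantiles and the dispersive order -/

lemma bddBelow_setOf_le_cdf (μ : Measure ℝ) {u : ℝ} (hu : 0 < u) :
    BddBelow {x : ℝ | u ≤ cdf μ x} := by
  obtain ⟨m, hm⟩ := ((tendsto_cdf_atBot μ).eventually (gt_mem_nhds hu)).exists
  refine ⟨m, fun x hx => ?_⟩
  by_contra! hlt
  exact (lt_of_lt_of_le hm hx).not_ge (monotone_cdf μ hlt.le)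

lemma quantile_le {μ : Measure ℝ} {u x : ℝ} (hu : 0 < u) (hx : u ≤ cdf μ x) :
    quantile μ u ≤ x :=
  csInf_le (bddBelow_setOf_le_cdf μ hu) hx

lemma cdf_quantile {μ : Measure ℝ} (hμ : Continuous (cdf μ)) {u : ℝ} (hu : 0 < u) (hu1 : u < 1) :
    cdf μ (quantile μ u) = u := by
  obtain ⟨M, hM⟩ := ((tendsto_cdf_atTop μ).eventually (lt_mem_nhds hu1)).exists
  have hclosed : IsClosed {x : ℝ | u ≤ cdf μ x} := isClosed_le continuous_const hμ
  have hge : u ≤ cdf μ (quantile μ u) :=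
    hclosed.csInf_mem ⟨M, hM.le⟩ (bddBelow_setOf_le_cdf μ hu)
  obtain ⟨m, hm⟩ := ((tendsto_cdf_atBot μ).eventually (gt_mem_nhds hu)).exists
  have hmq : m ≤ quantile μ u := by
    by_contra! hlt
    exact (lt_of_lt_of_le hm hge).not_ge (monotone_cdf μ hlt.le)
  obtain ⟨x, hx, hxu⟩ := intermediate_value_Icc hmq hμ.continuousOn ⟨hm.le, hge⟩
  exact le_antisymm ((monotone_cdf μ (quantile_le hu hxu.ge)).trans_eq hxu) hge

lemma quantile_sub_le_quantile_sub {a₁ a₂ b₁ b₂ : ℝ} (ha₁ : 0 < a₁) (ha : a₁ < a₂) (hb₁ : 0 < b₁)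
    (hb₂ : 0 < b₂) {u v : ℝ} (hu : 0 < u) (huv : u ≤ v) (hv : v < 1) :
    quantile (shapeEstimatorLaw a₁ b₁) v - quantile (shapeEstimatorLaw a₁ b₁) u ≤
      quantile (shapeEstimatorLaw a₂ b₂) v - quantile (shapeEstimatorLaw a₂ b₂) u := by
  have ha₂ := ha₁.trans ha
  set μ := shapeEstimatorLaw a₁ b₁
  set ν := shapeEstimatorLaw a₂ b₂
  obtain ⟨K, hF⟩ := exists_hasDerivAt_cdf_shapeEstimatorLaw ha₁ hb₁
  obtain ⟨K', hG⟩ := exists_hasDerivAt_cdf_shapeEstimatorLaw ha₂ hb₂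
  have hFc : Continuous (cdf μ) := continuous_cdf_shapeEstimatorLaw ha₁ hb₁
  have hGc : Continuous (cdf ν) := continuous_cdf_shapeEstimatorLaw ha₂ hb₂
  have hF0 : ∀ z ≤ 1, cdf μ z = 0 := fun z hz => cdf_shapeEstimatorLaw_of_le_one ha₁ hb₁ hz
  have hG0 : ∀ z ≤ 1, cdf ν z = 0 := fun z hz => cdf_shapeEstimatorLaw_of_le_one ha₂ hb₂ hz
  have hp : cdf μ (quantile μ u) = u := cdf_quantile hFc hu (huv.trans_lt hv)
  have hs : cdf ν (quantile ν u) = u := cdf_quantile hGc hu (huv.trans_lt hv)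
  have ht : cdf ν (quantile ν v) = v := cdf_quantile hGc (hu.trans_le huv) hv
  have hle : ∀ x, cdf ν x ≤ cdf μ x := le_of_logPDF hFc hGc hF0 hG0 (tendsto_cdf_atTop μ)
    (tendsto_cdf_atTop ν) hF hG ha
  have hps : quantile μ u ≤ quantile ν u := quantile_le hu (hs.ge.trans (hle _))
  have hp1 : 1 < quantile μ u := by
    by_contra! h
    rw [hF0 _ h] at hp
    exact hu.ne hp
  have hst : quantile ν u ≤ quantile ν v := quantile_le hu (huv.trans ht.ge)
  suffices h : quantile μ v ≤ quantile ν v - (quantile ν u - quantile μ u) by linarith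
  refine quantile_le (hu.trans_le huv) ?_
  rcases hps.eq_or_lt with h | h
  · rw [h, sub_self, sub_zero]
    exact ht.ge.trans (hle _)
  · refine ht.ge.trans (le_of_logPDF_of_eq hFc hGc hF0 hG0 (tendsto_cdf_atTop μ)
      (tendsto_cdf_atTop ν) hF hG ha (sub_pos.2 h) (by linarith) ?_ hst)
    rw [sub_sub_cancel, hp, hs]

theorem theorem3 {Ω₁ Ω₂ : Type*} [MeasurableSpace Ω₁] [MeasurableSpace Ω₂]
    (P₁ : Measure Ω₁) [IsProbabilityMeasure P₁] (P₂ : Measure Ω₂) [IsProbabilityMeasure P₂]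
    (α₁ α₂ l₁ l₂ : ℝ) (hα₁ : 0 < α₁) (hα : α₁ < α₂) (hl₁ : 0 < l₁) (hl₂ : 0 < l₂)
    (X : Fin 2 → Ω₁ → ℝ) (Y : Fin 2 → Ω₂ → ℝ)
    (hX : IsGammaSample X α₁ l₁ P₁) (hY : IsGammaSample Y α₂ l₂ P₂) :
    DispersiveLE (shapeEstimator X) P₁ (shapeEstimator Y) P₂ := by
  intro u v hu huv hv
  rw [hX.map_shapeEstimator, hY.map_shapeEstimator]
  exact quantile_sub_le_quantile_sub hα₁ hα (inv_pos.2 hl₁) (inv_pos.2 hl₂) hu huv hv
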